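/- Let $\mathcal H$ be a complex Hilbert space with an orthonormal basis $(|k\rangle)_{k\in\mathbb Z}$, let $Z$ be the selfadjoint operator with $Z|k\rangle=k|k\rangle$, and let $V_x=e^{ixZ}$ for $x\in\mathbb R$, so that $V_x|k\rangle=e^{ikx}|k\rangle$. A semispectral measure on $[0,2\pi)$ is a weakly countably additive map $E$ from the Borel subsets of $[0,2\pi)$ to the positive bounded operators on $\mathcal H$ with $E([0,2\pi))=I$. It is $\mathbb Z$-covariant (a box localization observable) if $V_xE(X)V_x^*=E(X\oplus x)$ for all Borel $X\subseteq[0,2\pi)$ and $x\in\mathbb R$, where $X\oplus x=\{y\in[0,2\pi): (y-x)\bmod 2\pi\in X\}$. A structure matrix of $E$ is a positive semidefinite matrix $B:\mathbb Z\times\mathbb Z\to\{z\in\mathbb C:|z|\le1\}$ with $B(k,k)=1$ for all $k$ such that $$\langle k|E(X)|l\rangle=B(k,l)\,\frac1{2\pi}\int_Xe^{i(k-l)x}\,dx\qquad(k,l\in\mathbb Z,\ X\subseteq[0,2\pi)\text{ Borel}).$$ Every such matrix $B$ is the structure matrix of a unique semispectral measure, denoted $E^B$; the canonical spectral measure $E^1$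 is the one with $B(k,l)=1$ for all $k,l$. Let $E^B$ be a $\mathbb Z$-covariant semispectral measure with structure matrix $B$. Then the following conditions are equivalent: (a) $E^B$ is noiseless: its noise operator $E^B[2]-E^B[1]^2$ is $0$, where $E^B[j]$ is the bounded operator with $\langle\varphi|E^B[j]\varphi\rangle=\int_0^{2\pi}x^j\,d\langle\varphi|E^B(x)\varphi\rangle$ for all $\varphi\in\mathcal H$; (b) $B$ is noiseless: for all $n\in\mathbb Z$ and all integers $l\ge0$, $$s_n^B(l)=M_n^{(l)}(1)-M_n^{(l)}(B)=0,\qquad M_n^{(l)}(C)=\sum_{k\in\mathbb Z}X_n^C(k)^l\,p_n(k),$$ where $p_n(k)=\frac{3}{\pi^2(k-n)^2}$ and $X_n^C(k)=\frac{\pi}{\sqrt3}|C(n,k)|$ for $k\ne n$, $p_n(n)=X_n^C(n)=0$, and $1$ denotes the matrix with all entries equal to $1$; (c) $|B(k,l)|=1$ for all $k,l\in\mathbb Z$; (d) $E^B$ is unitarily equivalent to $E^1$ as a covariance system: there is a unitary operator $U$ on $\mathcal H$ with $UE^B(X)U^*=E^1(X)$ for all Borel $X\subseteq[0,2\pi)$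 and $UV_xU^*=V_x$ for all $x\in\mathbb R$. -/

import Mathlib

open MeasureTheory
open scoped InnerProductSpace ComplexOrder

noncomputable section

namespace BoxLocalization

variable {H : Type*} [NormedAddCommGroup H] [InnerProductSpace ℂ H]

/-- The interval `[0, 2π)`, with its Borel sets and Lebesgue measure. -/
abbrev Box : Type := Set.Ico (0 : ℝ) (2 * Real.pi)

/-- Lebesgue measure on `[0, 2π)`. -/
instance : MeasureSpace Box := Measure.Subtype.measureSpace

/-- A semispectral measure (normalized positive operator measure) on the Borel subsets of
`[0, 2π)`: countably additive in the weak sense. -/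
structure SemispectralMeasure (H : Type*) [NormedAddCommGroup H] [InnerProductSpace ℂ H] where
  /-- The operator `E(X)`; as for Mathlib's vector measures, it is `0` on non-measurable sets. -/
  op : Set Box → H →L[ℂ] H
  op_not_measurable : ∀ X, ¬ MeasurableSet X → op X = 0
  op_pos : ∀ X, MeasurableSet X → (op X).IsPositive
  op_univ : op Set.univ = ContinuousLinearMap.id ℂ H
  op_iUnion : ∀ f : ℕ → Set Box, (∀ i, MeasurableSet (f i)) →
    Pairwise (Function.onFun Disjoint f) → ∀ φ ψ : H,
      HasSum (fun i => ⟪φ, op (f i) ψ⟫_ℂ) ⟪φ, op (⋃ i, f i) ψ⟫_ℂ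

namespace SemispectralMeasure

theorem op_empty (E : SemispectralMeasure H) : E.op ∅ = 0 := by
  ext ψ
  refine ext_inner_left ℂ fun φ => ?_
  have h := E.op_iUnion (fun _ => ∅) (fun _ => MeasurableSet.empty)
    (fun _ _ _ => disjoint_bot_left) φ ψ
  have h2 := h.summable.tendsto_atTop_zero
  simpa using tendsto_nhds_unique h2 tendsto_const_nhds |>.symm

theorem re_inner_nonneg (E : SemispectralMeasure H) (φ : H) (X : Set Box) :
    0 ≤ (⟪φ, E.op X φ⟫_ℂ).re := by
  by_cases hX : MeasurableSet X
  · exact (E.op_pos X hX).re_inner_nonneg_right φ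
  · simp [E.op_not_measurable X hX]

/-- The finite positive measure `X ↦ ⟨φ | E(X) φ⟩`. -/
def measure (E : SemispectralMeasure H) (φ : H) : Measure Box :=
  Measure.ofMeasurable (fun X _ => ENNReal.ofReal (⟪φ, E.op X φ⟫_ℂ).re)
    (by simp [E.op_empty])
    (by
      intro f hf hd
      have h := Complex.hasSum_re (E.op_iUnion f hf hd φ φ)
      rw [← h.tsum_eq, ENNReal.ofReal_tsum_of_nonneg (fun i => E.re_inner_nonneg φ (f i))
        h.summable])

theorem measure_apply (E : SemispectralMeasure H) (φ : H) {X : Set Box} (hX : MeasurableSet X) :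
    E.measure φ X = ENNReal.ofReal (⟪φ, E.op X φ⟫_ℂ).re :=
  Measure.ofMeasurable_apply X hX

theorem measure_real_univ (E : SemispectralMeasure H) (φ : H) :
    (E.measure φ).real Set.univ = ‖φ‖ ^ 2 := by
  rw [Measure.real, E.measure_apply φ MeasurableSet.univ,
    ENNReal.toReal_ofReal (E.re_inner_nonneg φ Set.univ), E.op_univ]
  simpa using inner_self_eq_norm_sq (𝕜 := ℂ) φ

instance (E : SemispectralMeasure H) (φ : H) : IsFiniteMeasure (E.measure φ) :=
  ⟨by rw [E.measure_apply φ MeasurableSet.univ]; exact ENNReal.ofReal_lt_top⟩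

/-- The operator of a simple function. -/
theorem exists_simple (E : SemispectralMeasure H) (g : SimpleFunc Box ℝ) :
    ∃ T : H →L[ℂ] H, ∀ φ, ⟪φ, T φ⟫_ℂ = ((∫ x, g x ∂(E.measure φ) : ℝ) : ℂ) := by
  refine ⟨∑ y ∈ g.range, (y : ℂ) • E.op (g ⁻¹' {y}), fun φ => ?_⟩
  have hi : Integrable g (E.measure φ) := SimpleFunc.integrable_of_isFiniteMeasure g
  rw [SimpleFunc.integral_eq_sum g hi, _root_.sum_apply, inner_sum,
    Complex.ofReal_sum]
  refine Finset.sum_congr rfl fun y _ => ?_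
  have hp := E.op_pos _ (g.measurableSet_fiber y)
  have : ((⟪φ, E.op (g ⁻¹' {y}) φ⟫_ℂ).re : ℂ) = ⟪φ, E.op (g ⁻¹' {y}) φ⟫_ℂ :=
    (RCLike.nonneg_iff_exists_ofReal.1 (hp.inner_nonneg_right φ)).elim
      fun r hr => by rw [← hr.2]; simp
  rw [Measure.real, E.measure_apply φ (g.measurableSet_fiber y),
    ENNReal.toReal_ofReal (E.re_inner_nonneg φ _), _root_.smul_apply,
    inner_smul_right, smul_eq_mul, Complex.ofReal_mul, this, mul_comm]

theorem norm_le_of_quadratic {T : H →L[ℂ] H} {C : ℝ} (hC : 0 ≤ C) (q : H → ℝ)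
    (hq : ∀ φ, ⟪φ, T φ⟫_ℂ = (q φ : ℂ)) (hb : ∀ φ, |q φ| ≤ C * ‖φ‖ ^ 2) : ‖T‖ ≤ C := by
  have hsymm : T.IsSymmetric := by
    refine (LinearMap.isSymmetric_iff_inner_map_self_real (T : H →ₗ[ℂ] H)).2 fun v => ?_
    rw [inner_conj_symm]
    have := hq v
    have h2 := inner_conj_symm (𝕜 := ℂ) (T v) v
    simp only [ContinuousLinearMap.coe_coe]
    rw [← h2, this, Complex.conj_ofReal]
  rw [ContinuousLinearMap.norm_eq_iSup_rayleighQuotient T hsymm]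
  refine ciSup_le fun x => ?_
  rw [ContinuousLinearMap.rayleighQuotient, ContinuousLinearMap.reApplyInnerSelf_apply, abs_div,
    abs_sq]
  have : RCLike.re ⟪T x, x⟫_ℂ = q x := by
    rw [← inner_conj_symm, hq x]; simp
  rw [this]
  exact div_le_of_le_mul₀ (sq_nonneg _) hC (hb x)

/-- The weak operator integral `∫ f dE` of a bounded measurable function exists. -/
theorem exists_integral [CompleteSpace H] (E : SemispectralMeasure H) (f : Box → ℝ)
    (hf : Measurable f) (C : ℝ) (hC : ∀ x, |f x| ≤ C) :
    ∃ T : H →L[ℂ] H, ∀ φ, ⟪φ, T φ⟫_ℂ = ((∫ x, f x ∂(E.measure φ) : ℝ) : ℂ) := by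
  have happ : ∀ n : ℕ, ∃ g : SimpleFunc Box ℝ, ∀ x, |f x - g x| ≤ 1 / ((n : ℝ) + 1) := by
    intro n
    have hn : (0 : ℝ) < (n : ℝ) + 1 := by positivity
    refine ⟨⟨fun x => (⌊((n : ℝ) + 1) * f x⌋ : ℝ) / ((n : ℝ) + 1), fun y => ?_, ?_⟩, fun x => ?_⟩
    · have : Measurable fun x => (⌊((n : ℝ) + 1) * f x⌋ : ℝ) / ((n : ℝ) + 1) := by fun_prop
      exact this (measurableSet_singleton y)
    · refine ((Set.finite_Icc (-⌈((n : ℝ) + 1) * C⌉ - 1) (⌈((n : ℝ) + 1) * C⌉ + 1)).image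
        (fun j : ℤ => (j : ℝ) / ((n : ℝ) + 1))).subset ?_
      rintro _ ⟨x, rfl⟩
      refine ⟨⌊((n : ℝ) + 1) * f x⌋, ⟨?_, ?_⟩, rfl⟩
      · rw [Int.le_floor]
        push_cast
        have h1 := Int.le_ceil (((n : ℝ) + 1) * C)
        have h2 := (abs_le.1 (hC x)).1
        nlinarith
      · have h1 : ((n : ℝ) + 1) * f x ≤ ((n : ℝ) + 1) * C :=
          mul_le_mul_of_nonneg_left (abs_le.1 (hC x)).2 hn.le
        have := (Int.floor_le_floor h1).trans (Int.floor_le_ceil _)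
        linarith
    · change |f x - (⌊((n : ℝ) + 1) * f x⌋ : ℝ) / ((n : ℝ) + 1)| ≤ 1 / ((n : ℝ) + 1)
      have h1 := Int.floor_le (((n : ℝ) + 1) * f x)
      have h2 := Int.lt_floor_add_one (((n : ℝ) + 1) * f x)
      have : f x - (⌊((n : ℝ) + 1) * f x⌋ : ℝ) / ((n : ℝ) + 1)
          = (((n : ℝ) + 1) * f x - ⌊((n : ℝ) + 1) * f x⌋) / ((n : ℝ) + 1) := by
        field_simp
      rw [this, abs_of_nonneg (div_nonneg (by linarith) hn.le)]
      exact div_le_div_of_nonneg_right (by linarith) hn.le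
  choose g hg using happ
  choose T hT using fun n => E.exists_simple (g n)
  have hgi : ∀ n φ, Integrable (g n) (E.measure φ) :=
    fun n φ => SimpleFunc.integrable_of_isFiniteMeasure _
  have hfi : ∀ φ, Integrable f (E.measure φ) := fun φ =>
    Integrable.of_bound hf.aestronglyMeasurable C (Filter.Eventually.of_forall hC)
  have hcauchy : CauchySeq T := by
    refine cauchySeq_of_le_tendsto_0 (fun N : ℕ => 2 * (1 / ((N : ℝ) + 1))) ?_ ?_
    · intro n m N hn hm
      rw [dist_eq_norm]
      have hN : (0 : ℝ) < (N : ℝ) + 1 := by positivity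
      have hn' : 1 / ((n : ℝ) + 1) ≤ 1 / ((N : ℝ) + 1) := by gcongr
      have hm' : 1 / ((m : ℝ) + 1) ≤ 1 / ((N : ℝ) + 1) := by gcongr
      refine norm_le_of_quadratic (by positivity)
        (fun φ => ∫ x, (g n x - g m x) ∂(E.measure φ)) (fun φ => ?_) (fun φ => ?_)
      · rw [integral_sub (hgi n φ) (hgi m φ), _root_.sub_apply, inner_sub_right, hT,
          hT]
        push_cast; ring
      · rw [← E.measure_real_univ φ, ← Real.norm_eq_abs]
        refine norm_integral_le_of_norm_le_const (Filter.Eventually.of_forall fun x => ?_)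
        have h1 := abs_le.1 (hg n x)
        have h2 := abs_le.1 (hg m x)
        rw [Real.norm_eq_abs, abs_le]
        constructor <;> linarith [h1.1, h1.2, h2.1, h2.2]
    · simpa using (tendsto_one_div_add_atTop_nhds_zero_nat (𝕜 := ℝ)).const_mul 2
  obtain ⟨S, hS⟩ := cauchySeq_tendsto_of_complete hcauchy
  refine ⟨S, fun φ => ?_⟩
  have hl : Filter.Tendsto (fun n => ⟪φ, T n φ⟫_ℂ) Filter.atTop (nhds ⟪φ, S φ⟫_ℂ) := by
    have h1 : Continuous fun A : H →L[ℂ] H => ⟪φ, A φ⟫_ℂ := by fun_prop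
    exact (h1.tendsto S).comp hS
  have hr : Filter.Tendsto (fun n => ∫ x, g n x ∂(E.measure φ)) Filter.atTop
      (nhds (∫ x, f x ∂(E.measure φ))) := by
    rw [tendsto_iff_dist_tendsto_zero]
    refine squeeze_zero (fun _ => dist_nonneg)
      (g := fun n : ℕ => 1 / ((n : ℝ) + 1) * (E.measure φ).real Set.univ) (fun n => ?_) ?_
    · rw [dist_comm, dist_eq_norm, ← integral_sub (hfi φ) (hgi n φ)]
      exact norm_integral_le_of_norm_le_const (Filter.Eventually.of_forall fun x => hg n x)
    · simpa using (tendsto_one_div_add_atTop_nhds_zero_nat (𝕜 := ℝ)).mul_const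
        ((E.measure φ).real Set.univ)
  refine tendsto_nhds_unique hl ?_
  simp_rw [hT]
  exact (Complex.continuous_ofReal.tendsto _).comp hr

theorem exists_moment [CompleteSpace H] (E : SemispectralMeasure H) (k : ℕ) :
    ∃ T : H →L[ℂ] H, ∀ φ, ⟪φ, T φ⟫_ℂ = ((∫ x, (x : ℝ) ^ k ∂(E.measure φ) : ℝ) : ℂ) := by
  refine E.exists_integral (fun x => (x : ℝ) ^ k) (by fun_prop) ((2 * Real.pi) ^ k) fun x => ?_
  rw [abs_of_nonneg (pow_nonneg x.2.1 k)]
  exact pow_le_pow_left₀ x.2.1 x.2.2.le k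

/-- The `k`-th moment operator `E[k] = ∫ x^k dE(x)`: the (unique) bounded operator with
`⟨φ | E[k] φ⟩ = ∫ x^k d⟨φ | E(x) φ⟩` for all vectors `φ`. -/
def moment [CompleteSpace H] (E : SemispectralMeasure H) (k : ℕ) : H →L[ℂ] H :=
  Classical.choose (E.exists_moment k)

theorem inner_moment [CompleteSpace H] (E : SemispectralMeasure H) (k : ℕ) (φ : H) :
    ⟪φ, E.moment k φ⟫_ℂ = ((∫ x, (x : ℝ) ^ k ∂(E.measure φ) : ℝ) : ℂ) :=
  Classical.choose_spec (E.exists_moment k) φ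

/-- The noise operator `E[2] - E[1]²`. -/
def noise [CompleteSpace H] (E : SemispectralMeasure H) : H →L[ℂ] H :=
  E.moment 2 - E.moment 1 ∘L E.moment 1

/-- `E` is noiseless if its noise operator vanishes. -/
def IsNoiseless [CompleteSpace H] (E : SemispectralMeasure H) : Prop := E.noise = 0

end SemispectralMeasure
/-- A normalized positive semidefinite matrix with entries in the closed unit disc. -/
structure IsNormalizedPSD (B : Matrix ℤ ℤ ℂ) : Prop where
  norm_le_one : ∀ k l, ‖B k l‖ ≤ 1
  diag : ∀ k, B k k = 1
  posSemidef : B.PosSemidef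

/-- `i_X(k, l) = (2π)⁻¹ ∫_X e^{i(k-l)x} dx`. -/
def boxFourier (X : Set Box) (k l : ℤ) : ℂ :=
  (1 / (2 * Real.pi) : ℂ) * ∫ x in X, Complex.exp (Complex.I * ((k : ℂ) - l) * ((x : ℝ) : ℂ))

/-- The entrywise product of `B` and `i_X`. -/
def boxMatrix (B : Matrix ℤ ℤ ℂ) (X : Set Box) : Matrix ℤ ℤ ℂ :=
  Matrix.of fun k l => B k l * boxFourier X k l

theorem boxMatrix_apply (B : Matrix ℤ ℤ ℂ) (X : Set Box) (k l : ℤ) :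
    boxMatrix B X k l = B k l * boxFourier X k l := rfl

instance : IsFiniteMeasure (volume : Measure Box) :=
  ⟨by rw [Measure.Subtype.volume_univ measurableSet_Ico.nullMeasurableSet]; exact measure_Ico_lt_top⟩

theorem posSemidef_finset {M : Matrix ℤ ℤ ℂ} (hM : M.PosSemidef) (s : Finset ℤ) (c : ℤ → ℂ) :
    0 ≤ ∑ i ∈ s, ∑ j ∈ s, star (c i) * M i j * c j := by
  have h := hM.2 (Finsupp.onFinset s (fun i => if i ∈ s then c i else 0) (by
    intro i hi; by_contra h; simp [h] at hi))
  rw [Finsupp.sum_of_support_subset _ Finsupp.support_onFinset_subset _ (by simp)] at h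
  refine h.trans_eq (Finset.sum_congr rfl fun i hi => ?_)
  rw [Finsupp.sum_of_support_subset _ Finsupp.support_onFinset_subset _ (by simp)]
  refine Finset.sum_congr rfl fun j hj => ?_
  simp [hi, hj]

theorem integrable_exp (X : Set Box) (k l : ℤ) : IntegrableOn (fun x : Box =>
    Complex.exp (Complex.I * ((k : ℂ) - l) * ((x : ℝ) : ℂ))) X := by
  refine Integrable.of_bound (by fun_prop) 1 (Filter.Eventually.of_forall fun x => ?_)
  rw [show Complex.I * ((k : ℂ) - l) * ((x : ℝ) : ℂ)
    = (((k - l : ℝ) * (x : ℝ) : ℝ) : ℂ) * Complex.I by push_cast; ring,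
    Complex.norm_exp_ofReal_mul_I]

theorem boxFourier_univ (k l : ℤ) : boxFourier Set.univ k l = if k = l then 1 else 0 := by
  have hpi : (Real.pi : ℂ) ≠ 0 := by exact_mod_cast Real.pi_ne_zero
  have h0 : (∫ x : Box in Set.univ, Complex.exp (Complex.I * ((k : ℂ) - l) * ((x : ℝ) : ℂ)))
      = ∫ x in (0 : ℝ)..(2 * Real.pi), Complex.exp (Complex.I * ((k : ℂ) - l) * (x : ℂ)) := by
    rw [setIntegral_univ, intervalIntegral.integral_of_le (by positivity),
      ← integral_Ico_eq_integral_Ioc]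
    exact integral_subtype measurableSet_Ico
      (fun x : ℝ => Complex.exp (Complex.I * ((k : ℂ) - l) * (x : ℂ)))
  rw [boxFourier, h0]
  split_ifs with h
  · subst h
    simp
    field_simp
  · have hc : Complex.I * ((k : ℂ) - l) ≠ 0 :=
      mul_ne_zero Complex.I_ne_zero (sub_ne_zero.2 (by exact_mod_cast h))
    rw [integral_exp_mul_complex hc]
    have : Complex.exp (Complex.I * ((k : ℂ) - l) * ((2 * Real.pi : ℝ) : ℂ)) = 1 := by
      rw [Complex.exp_eq_one_iff]
      exact ⟨k - l, by push_cast; ring⟩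
    rw [this]; simp

theorem boxMatrix_univ {B : Matrix ℤ ℤ ℂ} (hB : IsNormalizedPSD B) :
    boxMatrix B Set.univ = 1 := by
  ext k l
  rw [boxMatrix_apply, boxFourier_univ, Matrix.one_apply]
  split_ifs with h
  · subst h; simp [hB.diag]
  · simp

theorem boxMatrix_posSemidef {B : Matrix ℤ ℤ ℂ} (hB : IsNormalizedPSD B) (X : Set Box) :
    (boxMatrix B X).PosSemidef := by
  have hpi : (Real.pi : ℂ) ≠ 0 := by exact_mod_cast Real.pi_ne_zero
  constructor
  · ext k l
    rw [Matrix.conjTranspose_apply, boxMatrix_apply, boxMatrix_apply, star_mul', hB.posSemidef.1.apply]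
    congr 1
    rw [boxFourier, boxFourier, star_mul']
    congr 1
    · simp
    · rw [Complex.star_def, ← integral_conj]
      congr 1
      ext x
      rw [← Complex.exp_conj]
      congr 1
      simp
      ring
  · intro c
    have key : (c.sum fun i xi => c.sum fun j xj => star xi * boxMatrix B X i j * xj)
        = (1 / (2 * Real.pi) : ℂ) * ∫ x : Box in X, ∑ i ∈ c.support, ∑ j ∈ c.support,
          star (c i) * B i j * c j * Complex.exp (Complex.I * ((i : ℂ) - j) * ((x : ℝ) : ℂ)) := by
      rw [integral_finsetSum _ fun i _ => integrable_finsetSum _ fun j _ =>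
        (integrable_exp X i j).const_mul _, Finset.mul_sum]
      refine Finset.sum_congr rfl fun i _ => ?_
      rw [integral_finsetSum _ fun j _ => (integrable_exp X i j).const_mul _, Finset.mul_sum]
      refine Finset.sum_congr rfl fun j _ => ?_
      change star (c i) * boxMatrix B X i j * c j = _
      rw [integral_const_mul, boxMatrix_apply, boxFourier]
      ring
    rw [key]
    refine mul_nonneg ?_ ?_
    · have : (0 : ℝ) ≤ 1 / (2 * Real.pi) := by positivity
      exact_mod_cast this
    · have hnn : ∀ x : Box, 0 ≤ ∑ i ∈ c.support, ∑ j ∈ c.support,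
          star (c i) * B i j * c j * Complex.exp (Complex.I * ((i : ℂ) - j) * ((x : ℝ) : ℂ)) := by
        intro x
        refine (posSemidef_finset hB.posSemidef c.support
          (fun i => c i * Complex.exp (-Complex.I * i * ((x : ℝ) : ℂ)))).trans_eq
          (Finset.sum_congr rfl fun i _ => Finset.sum_congr rfl fun j _ => ?_)
        simp only [star_mul', Complex.star_def]
        rw [← Complex.exp_conj,
          show Complex.I * ((i : ℂ) - j) * ((x : ℝ) : ℂ)
            = (starRingEnd ℂ) (-Complex.I * i * ((x : ℝ) : ℂ)) + -Complex.I * j * ((x : ℝ) : ℂ) by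
            simp; ring, Complex.exp_add]
        ring
      exact integral_nonneg hnn


theorem boxFourier_iUnion (f : ℕ → Set Box) (hf : ∀ i, MeasurableSet (f i))
    (hd : Pairwise (Function.onFun Disjoint f)) (k l : ℤ) :
    HasSum (fun i => boxFourier (f i) k l) (boxFourier (⋃ i, f i) k l) :=
  (hasSum_integral_iUnion hf hd (integrable_exp _ k l)).mul_left _

theorem boxFourier_union {X Y : Set Box} (hY : MeasurableSet Y) (hd : Disjoint X Y) (k l : ℤ) :
    boxFourier (X ∪ Y) k l = boxFourier X k l + boxFourier Y k l := by
  rw [boxFourier, setIntegral_union hd hY (integrable_exp _ k l) (integrable_exp _ k l), mul_add]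
  rfl

theorem one_sub_boxMatrix_posSemidef {B : Matrix ℤ ℤ ℂ} (hB : IsNormalizedPSD B) {X : Set Box}
    (hX : MeasurableSet X) : (1 - boxMatrix B X).PosSemidef := by
  have : 1 - boxMatrix B X = boxMatrix B Xᶜ := by
    rw [← boxMatrix_univ hB, sub_eq_iff_eq_add']
    ext k l
    rw [Matrix.add_apply, boxMatrix_apply, boxMatrix_apply, boxMatrix_apply, ← mul_add,
      ← boxFourier_union hX.compl disjoint_compl_right, Set.union_compl_self]
  rw [this]
  exact boxMatrix_posSemidef hB _

theorem dense_linearCombination (b : HilbertBasis ℤ ℂ H) :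
    DenseRange (Finsupp.linearCombination ℂ (b : ℤ → H)) := by
  have h := b.dense_span
  rw [← Finsupp.range_linearCombination] at h
  rw [DenseRange, ← LinearMap.coe_range]
  exact (Submodule.dense_iff_topologicalClosure_eq_top).2 h

theorem norm_sq_linearCombination (b : HilbertBasis ℤ ℂ H) (d : ℤ →₀ ℂ) {s : Finset ℤ}
    (hs : d.support ⊆ s) :
    ‖Finsupp.linearCombination ℂ (b : ℤ → H) d‖ ^ 2 = ∑ k ∈ s, ‖d k‖ ^ 2 := by
  have h : ((‖Finsupp.linearCombination ℂ (b : ℤ → H) d‖ : ℂ)) ^ 2 = ∑ k ∈ s, (‖d k‖ : ℂ) ^ 2 := by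
    have := inner_self_eq_norm_sq_to_K (𝕜 := ℂ) (Finsupp.linearCombination ℂ (b : ℤ → H) d)
    refine this.symm.trans ?_
    rw [b.orthonormal.inner_finsupp_eq_sum_left, Finsupp.sum_of_support_subset _ hs _ (by simp)]
    exact Finset.sum_congr rfl fun k _ => RCLike.conj_mul _
  exact_mod_cast h

/-- The coordinates of `M d` are square summable, with norm at most that of `d`. -/
theorem sum_norm_sq_le {M : Matrix ℤ ℤ ℂ} (hM : M.PosSemidef) (hM1 : (1 - M).PosSemidef)
    (b : HilbertBasis ℤ ℂ H) (d : ℤ →₀ ℂ) (s : Finset ℤ) :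
    ∑ k ∈ s, ‖d.sum fun l z => M k l * z‖ ^ 2
      ≤ ‖Finsupp.linearCombination ℂ (b : ℤ → H) d‖ ^ 2 := by
  classical
  set t := s ∪ d.support
  have hd : d.support ⊆ t := Finset.subset_union_right
  set v : ℤ → ℂ := fun k => d.sum fun l z => M k l * z
  have hv : ∀ k, v k = ∑ l ∈ t, M k l * d l := fun k =>
    Finsupp.sum_of_support_subset _ hd _ (by simp)
  refine (Finset.sum_le_sum_of_subset_of_nonneg Finset.subset_union_left
    fun _ _ _ => sq_nonneg _).trans (?_ : ∑ k ∈ t, ‖v k‖ ^ 2 ≤ _)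
  rw [norm_sq_linearCombination b d hd]
  have hvd : ∑ i ∈ t, ∑ j ∈ t, star (v i) * M i j * d j = ((∑ k ∈ t, ‖v k‖ ^ 2 : ℝ) : ℂ) := by
    push_cast
    refine Finset.sum_congr rfl fun i _ => ?_
    simp_rw [mul_assoc]
    rw [← Finset.mul_sum, ← hv i]
    exact RCLike.conj_mul _
  have hdv : ∑ i ∈ t, ∑ j ∈ t, star (d i) * M i j * v j = ((∑ k ∈ t, ‖v k‖ ^ 2 : ℝ) : ℂ) := by
    have h := congrArg star hvd
    rw [Complex.star_def, Complex.conj_ofReal] at h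
    rw [← h, map_sum, Finset.sum_comm]
    refine Finset.sum_congr rfl fun i _ => ?_
    rw [map_sum]
    refine Finset.sum_congr rfl fun j _ => ?_
    rw [← hM.1.apply j i]
    simp only [map_mul, Complex.star_def, Complex.conj_conj]
    ring
  have h1 : ∀ c : ℤ → ℂ, (∑ i ∈ t, ∑ j ∈ t, star (c i) * M i j * c j).re
      ≤ ∑ k ∈ t, ‖c k‖ ^ 2 := by
    intro c
    have h := (Complex.le_def.1 (posSemidef_finset hM1 t c)).1
    have e : ∑ i ∈ t, ∑ j ∈ t, star (c i) * (1 - M) i j * c j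
        = ((∑ k ∈ t, ‖c k‖ ^ 2 : ℝ) : ℂ) - ∑ i ∈ t, ∑ j ∈ t, star (c i) * M i j * c j := by
      push_cast
      rw [← Finset.sum_sub_distrib]
      refine Finset.sum_congr rfl fun i hi => ?_
      simp_rw [Matrix.sub_apply, mul_sub, sub_mul]
      rw [Finset.sum_sub_distrib]
      congr 1
      simp only [Matrix.one_apply, mul_ite, mul_one, mul_zero, ite_mul, zero_mul]
      rw [Finset.sum_ite_eq, if_pos hi]
      exact RCLike.conj_mul _
    rw [e, Complex.sub_re, Complex.ofReal_re, Complex.zero_re] at h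
    linarith
  have h2 := (Complex.le_def.1 (posSemidef_finset hM t (fun k => v k - d k))).1
  have e2 : ∑ i ∈ t, ∑ j ∈ t, star (v i - d i) * M i j * (v j - d j)
      = (∑ i ∈ t, ∑ j ∈ t, star (v i) * M i j * v j)
        - (∑ i ∈ t, ∑ j ∈ t, star (v i) * M i j * d j)
        - (∑ i ∈ t, ∑ j ∈ t, star (d i) * M i j * v j)
        + ∑ i ∈ t, ∑ j ∈ t, star (d i) * M i j * d j := by
    simp only [← Finset.sum_sub_distrib, ← Finset.sum_add_distrib]
    refine Finset.sum_congr rfl fun i _ => Finset.sum_congr rfl fun j _ => ?_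
    rw [star_sub]; ring
  rw [e2, hvd, hdv] at h2
  simp only [Complex.zero_re, Complex.add_re, Complex.sub_re, Complex.ofReal_re] at h2
  linarith [h1 v, h1 d]

theorem ext_matrix (b : HilbertBasis ℤ ℂ H) {S T : H →L[ℂ] H}
    (h : ∀ k l, ⟪b k, S (b l)⟫_ℂ = ⟪b k, T (b l)⟫_ℂ) : S = T := by
  refine ContinuousLinearMap.ext_on
    ((Submodule.dense_iff_topologicalClosure_eq_top).2 b.dense_span) ?_
  rintro _ ⟨l, rfl⟩
  apply b.repr.injective
  ext k
  rw [b.repr_apply_apply, b.repr_apply_apply, h]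

/-- A matrix with `0 ≤ M ≤ 1` is the matrix of a positive contraction. -/
theorem exists_operator [CompleteSpace H] (b : HilbertBasis ℤ ℂ H) {M : Matrix ℤ ℤ ℂ}
    (hM : M.PosSemidef) (hM1 : (1 - M).PosSemidef) :
    ∃ T : H →L[ℂ] H, (∀ k l, ⟪b k, T (b l)⟫_ℂ = M k l) ∧ T.IsPositive ∧ ‖T‖ ≤ 1 := by
  classical
  have hmem : ∀ d : ℤ →₀ ℂ, Memℓp (fun k => d.sum fun l z => M k l * z) 2 := fun d =>
    memℓp_gen' (C := ‖Finsupp.linearCombination ℂ (b : ℤ → H) d‖ ^ 2) fun s => by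
      simpa using sum_norm_sq_le hM hM1 b d s
  let L : (ℤ →₀ ℂ) →ₗ[ℂ] H := b.repr.symm.toLinearEquiv.toLinearMap ∘ₗ
    { toFun := fun d => (⟨_, hmem d⟩ : lp (fun _ : ℤ => ℂ) 2)
      map_add' := fun c d => by
        ext k
        exact Finsupp.sum_add_index' (by simp) (by intros; ring)
      map_smul' := fun a d => by
        ext k
        refine (Finsupp.sum_smul_index (by simp)).trans ?_
        simp only [RingHom.id_apply, lp.coeFn_smul, Pi.smul_apply, smul_eq_mul]
        rw [Finsupp.mul_sum]
        exact Finset.sum_congr rfl fun _ _ => by ring }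
  have hL : ∀ d k, ⟪b k, L d⟫_ℂ = d.sum fun l z => M k l * z := fun d k => by
    rw [← b.repr_apply_apply]
    simp [L]
  have hbound : ∀ d, ‖L d‖ ≤ 1 * ‖Finsupp.linearCombination ℂ (b : ℤ → H) d‖ := fun d => by
    rw [one_mul, ← b.repr.norm_map]
    refine lp.norm_le_of_forall_sum_le (by simp) (norm_nonneg _) fun s => ?_
    have : ∀ k, b.repr (L d) k = d.sum fun l z => M k l * z := fun k => by
      rw [b.repr_apply_apply, hL]
    simpa [this] using sum_norm_sq_le hM hM1 b d s
  have hdense := dense_linearCombination b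
  set T : H →L[ℂ] H := L.extendOfNorm (Finsupp.linearCombination ℂ (b : ℤ → H)) with hT
  have hTe : ∀ d, T (Finsupp.linearCombination ℂ (b : ℤ → H) d) = L d :=
    LinearMap.extendOfNorm_eq hdense ⟨1, hbound⟩
  have hmat : ∀ k l, ⟪b k, T (b l)⟫_ℂ = M k l := fun k l => by
    have := hTe (Finsupp.single l 1)
    rw [Finsupp.linearCombination_single, one_smul] at this
    rw [this, hL]
    simp
  refine ⟨T, hmat, ⟨?_, fun x => ?_⟩, ?_⟩
  · have : T = ContinuousLinearMap.adjoint T := ext_matrix b fun k l => by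
      rw [ContinuousLinearMap.adjoint_inner_right, hmat, ← inner_conj_symm, hmat]
      exact (hM.1.apply k l).symm
    exact (ContinuousLinearMap.isSelfAdjoint_iff_isSymmetric).1 this.symm
  · refine hdense.induction_on (p := fun x => 0 ≤ T.reApplyInnerSelf x) x
      (isClosed_le continuous_const T.reApplyInnerSelf_continuous) fun d => ?_
    rw [ContinuousLinearMap.reApplyInnerSelf_apply, ← inner_re_symm, hTe,
      Finsupp.linearCombination_apply, Finsupp.sum_inner]
    have := (Complex.le_def.1 (hM.2 d)).1
    convert! this using 2
    refine Finset.sum_congr rfl fun i _ => ?_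
    simp only [inner_smul_left, hL]
    rw [Finsupp.mul_sum]
    exact Finset.sum_congr rfl fun _ _ => (mul_assoc _ _ _).symm
  · exact T.opNorm_le_bound zero_le_one
      (LinearMap.norm_extendOfNorm_apply_le hdense 1 hbound)

/-- The operator whose matrix in the basis `b` is the entrywise product of `B` and `i_X`. -/
theorem exists_boxOperator [CompleteSpace H] (b : HilbertBasis ℤ ℂ H) {B : Matrix ℤ ℤ ℂ}
    (hB : IsNormalizedPSD B) (X : Set Box) : ∃ T : H →L[ℂ] H,
      (MeasurableSet X → ∀ k l, ⟪b k, T (b l)⟫_ℂ = B k l * boxFourier X k l) ∧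
      (¬ MeasurableSet X → T = 0) ∧ T.IsPositive ∧ ‖T‖ ≤ 1 := by
  by_cases hX : MeasurableSet X
  · obtain ⟨T, h1, h2, h3⟩ := exists_operator b (boxMatrix_posSemidef hB X)
      (one_sub_boxMatrix_posSemidef hB hX)
    exact ⟨T, fun _ => h1, fun h => (h hX).elim, h2, h3⟩
  · exact ⟨0, fun h => (hX h).elim, fun _ => rfl, ContinuousLinearMap.isPositive_zero, by simp⟩

theorem tendsto_weak {ι : Type*} {F : Filter ι} (b : HilbertBasis ℤ ℂ H) (A : ι → H →L[ℂ] H)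
    (hA : ∀ i, ‖A i‖ ≤ 1) (T : H →L[ℂ] H)
    (h : ∀ k l, Filter.Tendsto (fun i => ⟪b k, A i (b l)⟫_ℂ) F (nhds ⟪b k, T (b l)⟫_ℂ)) (φ ψ : H) :
    Filter.Tendsto (fun i => ⟪φ, A i ψ⟫_ℂ) F (nhds ⟪φ, T ψ⟫_ℂ) := by
  have hspan : ∀ x : H, x ∈ closure (Submodule.span ℂ (Set.range b) : Set H) :=
    (Submodule.dense_iff_topologicalClosure_eq_top).2 b.dense_span
  have hle : ∀ i φ ψ, ‖⟪φ, A i ψ⟫_ℂ‖ ≤ ‖φ‖ * ‖ψ‖ := fun i φ ψ =>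
    (norm_inner_le_norm _ _).trans (mul_le_mul_of_nonneg_left
      (((A i).le_opNorm ψ).trans (mul_le_of_le_one_left (norm_nonneg _) (hA i))) (norm_nonneg _))
  have step1 : ∀ k ψ, Filter.Tendsto (fun i => ⟪b k, A i ψ⟫_ℂ) F (nhds ⟪b k, T ψ⟫_ℂ) := by
    intro k ψ
    have heq : Equicontinuous fun i (ψ : H) => ⟪b k, A i ψ⟫_ℂ :=
      (LipschitzWith.uniformEquicontinuous _ 1 fun i => LipschitzWith.of_dist_le_mul fun x y => by
        rw [dist_eq_norm, dist_eq_norm, ← inner_sub_right, ← map_sub]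
        refine (hle i (b k) (x - y)).trans_eq ?_
        rw [b.orthonormal.norm_eq_one k, NNReal.coe_one]).equicontinuous
    refine closure_minimal (t := {ψ | Filter.Tendsto (fun i => ⟪b k, A i ψ⟫_ℂ) F
      (nhds ⟪b k, T ψ⟫_ℂ)}) (fun x hx => ?_)
      (heq.isClosed_setOfPred_tendsto (f := fun ψ => ⟪b k, T ψ⟫_ℂ) (by fun_prop)) (hspan ψ)
    refine Submodule.span_induction (p := fun x _ => Filter.Tendsto (fun i => ⟪b k, A i x⟫_ℂ) F
      (nhds ⟪b k, T x⟫_ℂ)) ?_ ?_ ?_ ?_ hx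
    · rintro _ ⟨l, rfl⟩; exact h k l
    · simpa using tendsto_const_nhds
    · intro x y _ _ hx hy; simpa [inner_add_right] using hx.add hy
    · intro a x _ hx; simpa [inner_smul_right] using hx.const_mul a
  have heq : Equicontinuous fun i (φ : H) => ⟪φ, A i ψ⟫_ℂ :=
    (LipschitzWith.uniformEquicontinuous _ ‖ψ‖₊ fun i => LipschitzWith.of_dist_le_mul fun x y => by
      rw [dist_eq_norm, dist_eq_norm, ← inner_sub_left, mul_comm]
      exact hle i (x - y) ψ).equicontinuous
  refine closure_minimal (t := {φ | Filter.Tendsto (fun i => ⟪φ, A i ψ⟫_ℂ) F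
    (nhds ⟪φ, T ψ⟫_ℂ)}) (fun x hx => ?_)
    (heq.isClosed_setOfPred_tendsto (f := fun φ => ⟪φ, T ψ⟫_ℂ) (by fun_prop)) (hspan φ)
  refine Submodule.span_induction (p := fun x _ => Filter.Tendsto (fun i => ⟪x, A i ψ⟫_ℂ) F
    (nhds ⟪x, T ψ⟫_ℂ)) ?_ ?_ ?_ ?_ hx
  · rintro _ ⟨l, rfl⟩; exact step1 l ψ
  · simpa using tendsto_const_nhds
  · intro x y _ _ hx hy; simpa [inner_add_left] using hx.add hy
  · intro a x _ hx; simpa [inner_smul_left] using hx.mul_const _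

/-- The semispectral measure `E^B` with `⟨k | E^B(X) | l⟩ = B(k, l) i_X(k, l)`. -/
def boxObservable [CompleteSpace H] (b : HilbertBasis ℤ ℂ H) (B : Matrix ℤ ℤ ℂ)
    (hB : IsNormalizedPSD B) : SemispectralMeasure H where
  op X := Classical.choose (exists_boxOperator b hB X)
  op_not_measurable X := (Classical.choose_spec (exists_boxOperator b hB X)).2.1
  op_pos X _ := (Classical.choose_spec (exists_boxOperator b hB X)).2.2.1
  op_univ := ext_matrix b fun k l => by
    rw [(Classical.choose_spec (exists_boxOperator b hB Set.univ)).1 MeasurableSet.univ,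
      ← boxMatrix_apply, boxMatrix_univ hB, Matrix.one_apply]
    exact (orthonormal_iff_ite.1 b.orthonormal k l).symm
  op_iUnion f hf hd φ ψ := by
    have spec := fun X => Classical.choose_spec (exists_boxOperator b hB X)
    set T : Set Box → H →L[ℂ] H := fun X => Classical.choose (exists_boxOperator b hB X)
    have hval : ∀ i k l, ⟪b k, T (f i) (b l)⟫_ℂ = B k l * boxFourier (f i) k l :=
      fun i => (spec (f i)).1 (hf i)
    have hfin : ∀ s : Finset ℕ, ∑ i ∈ s, T (f i) = T (⋃ i ∈ s, f i) := fun s =>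
      ext_matrix b fun k l => by
        rw [show ⟪b k, T (⋃ i ∈ s, f i) (b l)⟫_ℂ = _ from
          (spec _).1 (s.measurableSet_biUnion fun i _ => hf i) k l, _root_.sum_apply, inner_sum]
        simp_rw [hval]
        rw [boxFourier, integral_biUnion_finset s (fun i _ => hf i)
          (fun i _ j _ hij => hd hij) (fun i _ => integrable_exp _ k l), Finset.mul_sum, Finset.mul_sum]
        rfl
    have h := tendsto_weak (F := Filter.atTop) b (fun s : Finset ℕ => ∑ i ∈ s, T (f i))
      (fun s => by rw [hfin]; exact (spec _).2.2.2) (T (⋃ i, f i)) (fun k l => by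
        simp_rw [_root_.sum_apply, inner_sum]
        simp_rw [hval]
        rw [show ⟪b k, T (⋃ i, f i) (b l)⟫_ℂ = _ from (spec _).1 (MeasurableSet.iUnion hf) k l]
        exact (boxFourier_iUnion f hf hd k l).mul_left (B k l)) φ ψ
    simp_rw [_root_.sum_apply, inner_sum] at h
    exact h

/-- `B` is the structure matrix of `E` with respect to the basis `b`: it is normalized and positive
semidefinite with entries in the unit disc, and `E(X) = ∑ B(k, l) i_X(k, l) |k⟩⟨l|` weakly. -/
structure IsStructureMatrix (b : HilbertBasis ℤ ℂ H) (E : SemispectralMeasure H)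
    (B : Matrix ℤ ℤ ℂ) : Prop where
  normalizedPSD : IsNormalizedPSD B
  inner_op : ∀ X, MeasurableSet X → ∀ k l, ⟪b k, E.op X (b l)⟫_ℂ = B k l * boxFourier X k l

theorem boxObservable_isStructureMatrix [CompleteSpace H] (b : HilbertBasis ℤ ℂ H)
    (B : Matrix ℤ ℤ ℂ) (hB : IsNormalizedPSD B) : IsStructureMatrix b (boxObservable b B hB) B :=
  ⟨hB, fun X => (Classical.choose_spec (exists_boxOperator b hB X)).1⟩

/-- The matrix `B¹` with all entries equal to one. -/
def oneMatrix : Matrix ℤ ℤ ℂ := Matrix.of fun _ _ => 1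

theorem oneMatrix_isNormalizedPSD : IsNormalizedPSD oneMatrix where
  norm_le_one _ _ := by simp [oneMatrix]
  diag _ := rfl
  posSemidef := by
    refine ⟨by ext; simp [oneMatrix], fun c => ?_⟩
    have : (c.sum fun i xi => c.sum fun j xj => star xi * oneMatrix i j * xj)
        = star (c.sum fun _ x => x) * c.sum fun _ x => x := by
      simp only [oneMatrix, Matrix.of_apply, mul_one, Finsupp.sum, star_sum]
      rw [Finset.sum_mul_sum]
    rw [this]
    exact star_mul_self_nonneg _

/-- The canonical spectral measure `E¹`. -/
def canonicalObservable [CompleteSpace H] (b : HilbertBasis ℤ ℂ H) : SemispectralMeasure H :=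
  boxObservable b oneMatrix oneMatrix_isNormalizedPSD

/-- The basis `(e^{ikx} |k⟩)`. -/
def phaseBasis [CompleteSpace H] (b : HilbertBasis ℤ ℂ H) (x : ℝ) : HilbertBasis ℤ ℂ H :=
  HilbertBasis.mk (v := fun k : ℤ => Complex.exp (Complex.I * (x : ℂ) * (k : ℂ)) • b k)
    (by
      rw [orthonormal_iff_ite]
      intro k l
      rw [inner_smul_left, inner_smul_right, orthonormal_iff_ite.1 b.orthonormal k l]
      split_ifs with h
      · subst h
        rw [mul_one, ← Complex.exp_conj, ← Complex.exp_add]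
        simp
      · simp)
    (by
      rw [← b.dense_span]
      refine Submodule.topologicalClosure_mono (Submodule.span_le.2 ?_)
      rintro _ ⟨k, rfl⟩
      have h := Submodule.smul_mem _ (Complex.exp (Complex.I * (x : ℂ) * (k : ℂ)))⁻¹
        (Submodule.subset_span (R := ℂ) (Set.mem_range_self
          (f := fun k : ℤ => Complex.exp (Complex.I * (x : ℂ) * (k : ℂ)) • b k) k))
      rwa [inv_smul_smul₀ (Complex.exp_ne_zero _)] at h)

/-- The unitary operator `V_x = e^{ixZ}`, where `Z |k⟩ = k |k⟩`; that is,
`V_x |k⟩ = e^{ikx} |k⟩`. -/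
def translation [CompleteSpace H] (b : HilbertBasis ℤ ℂ H) (x : ℝ) : H ≃ₗᵢ[ℂ] H :=
  b.repr.trans (phaseBasis b x).repr.symm

theorem translation_apply [CompleteSpace H] (b : HilbertBasis ℤ ℂ H) (x : ℝ) (k : ℤ) :
    translation b x (b k) = Complex.exp (Complex.I * (x : ℂ) * (k : ℂ)) • b k := by
  classical
  rw [translation, LinearIsometryEquiv.trans_apply, b.repr_self, HilbertBasis.repr_symm_single,
    phaseBasis, HilbertBasis.coe_mk]

/-- The operator `U T U*`. -/
def conjugate (U : H ≃ₗᵢ[ℂ] H) (T : H →L[ℂ] H) : H →L[ℂ] H :=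
  (U : H →L[ℂ] H) ∘L T ∘L (U.symm : H →L[ℂ] H)

/-- The translate `X ⊕ x = {y ∈ [0, 2π) | (y - x) mod 2π ∈ X}`. -/
def boxTranslate (X : Set Box) (x : ℝ) : Set Box :=
  {y | (⟨toIcoMod Real.two_pi_pos 0 ((y : ℝ) - x), toIcoMod_mem_Ico' Real.two_pi_pos _⟩ : Box) ∈ X}

/-- `E` is `ℤ`-covariant: `V_x E(X) V_x* = E(X ⊕ x)`. -/
def IsCovariant [CompleteSpace H] (b : HilbertBasis ℤ ℂ H) (E : SemispectralMeasure H) : Prop :=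
  ∀ X, MeasurableSet X → ∀ x : ℝ,
    conjugate (translation b x) (E.op X) = E.op (boxTranslate X x)

/-- Unitary equivalence of `E` and `F` as covariance systems with the representation `x ↦ V_x`:
some unitary operator intertwines the two measures and the representation with itself. -/
def IsUnitarilyEquivalent [CompleteSpace H] (b : HilbertBasis ℤ ℂ H)
    (E F : SemispectralMeasure H) : Prop :=
  ∃ U : H ≃ₗᵢ[ℂ] H, (∀ X, MeasurableSet X → conjugate U (E.op X) = F.op X) ∧
    ∀ x : ℝ, conjugate U (translation b x : H →L[ℂ] H) = (translation b x : H →L[ℂ] H)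

/-- The probability `p_n({k})`. -/
def prob (n k : ℤ) : ℝ :=
  if k = n then 0 else 3 / (Real.pi ^ 2 * ((k : ℝ) - n) ^ 2)

/-- The random variable `X_n^B`. -/
def randomVar (B : Matrix ℤ ℤ ℂ) (n k : ℤ) : ℝ :=
  if k = n then 0 else Real.pi / √3 * ‖B n k‖

/-- The `l`-th moment of `X_n^B` with respect to `p_n`. -/
def matrixMoment (B : Matrix ℤ ℤ ℂ) (n : ℤ) (l : ℕ) : ℝ :=
  ∑' k : ℤ, randomVar B n k ^ l * prob n k

/-- The `n`-th noise sequence `l ↦ s_n^B(l)` of `B`. -/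
def noiseSequence (B : Matrix ℤ ℤ ℂ) (n : ℤ) (l : ℕ) : ℝ :=
  matrixMoment oneMatrix n l - matrixMoment B n l

/-- `B` is noiseless if all its noise sequences vanish. -/
def IsNoiselessMatrix (B : Matrix ℤ ℤ ℂ) : Prop :=
  ∀ (n : ℤ) (l : ℕ), noiseSequence B n l = 0

theorem summable_prob (n : ℤ) : Summable (prob n) := by
  have h : Summable fun m : ℤ => 3 / Real.pi ^ 2 * (1 / (m : ℝ) ^ 2) :=
    (Real.summable_one_div_int_pow.2 one_lt_two).mul_left _
  refine (((Equiv.subRight n).summable_iff).2 h).congr fun k => ?_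
  simp only [Function.comp_apply, Equiv.subRight_apply, prob]
  split_ifs with hk
  · simp [hk]
  · push_cast; rw [div_mul_div_comm, mul_one]

/-- For entries in the unit disc, the vanishing of all noise sequences already follows if
`s_n^B(l₀) = 0` for all `n` and a single `l₀ ≥ 1`. -/
theorem isNoiselessMatrix_iff {B : Matrix ℤ ℤ ℂ} (hB : ∀ k l, ‖B k l‖ ≤ 1) :
    IsNoiselessMatrix B ↔ ∃ l₀ : ℕ, 1 ≤ l₀ ∧ ∀ n : ℤ, noiseSequence B n l₀ = 0 := by
  refine ⟨fun h => ⟨1, le_rfl, fun n => h n 1⟩, ?_⟩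
  rintro ⟨l₀, hl₀, h⟩
  have hp : ∀ n k, 0 ≤ prob n k := fun n k => by
    rw [prob]; split_ifs
    · exact le_rfl
    · positivity
  have hc : 0 < Real.pi / √3 := by positivity
  have hX0 : ∀ (C : Matrix ℤ ℤ ℂ) n k, 0 ≤ randomVar C n k := fun C n k => by
    rw [randomVar]; split_ifs
    · exact le_rfl
    · positivity
  have hone : ∀ k l, ‖oneMatrix k l‖ ≤ 1 := oneMatrix_isNormalizedPSD.norm_le_one
  have hX1 : ∀ (C : Matrix ℤ ℤ ℂ), (∀ k l, ‖C k l‖ ≤ 1) → ∀ n k,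
      randomVar C n k ≤ Real.pi / √3 := fun C hC n k => by
    rw [randomVar]; split_ifs
    · exact hc.le
    · exact mul_le_of_le_one_right hc.le (hC n k)
  have hsum : ∀ (C : Matrix ℤ ℤ ℂ), (∀ k l, ‖C k l‖ ≤ 1) → ∀ n,
      Summable fun k => randomVar C n k ^ l₀ * prob n k := fun C hC n =>
    Summable.of_nonneg_of_le (fun k => mul_nonneg (pow_nonneg (hX0 C n k) _) (hp n k))
      (fun k => mul_le_mul_of_nonneg_right
        (pow_le_pow_left₀ (hX0 C n k) (hX1 C hC n k) l₀) (hp n k))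
      ((summable_prob n).mul_left _)
  have hle : ∀ n k, randomVar B n k ≤ randomVar oneMatrix n k := fun n k => by
    rw [randomVar, randomVar]; split_ifs
    · exact le_rfl
    · exact mul_le_mul_of_nonneg_left ((hB n k).trans_eq (by simp [oneMatrix])) hc.le
  have heq : ∀ n k, randomVar B n k = randomVar oneMatrix n k := by
    intro n k
    by_cases hk : k = n
    · simp [randomVar, hk]
    have hz : ∑' j, (randomVar oneMatrix n j ^ l₀ * prob n j - randomVar B n j ^ l₀ * prob n j)
        = 0 := by
      rw [(hsum _ hone n).tsum_sub (hsum _ hB n)]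
      exact h n
    have h0 := (hasSum_zero_iff_of_nonneg (fun j => sub_nonneg.2 (mul_le_mul_of_nonneg_right
      (pow_le_pow_left₀ (hX0 B n j) (hle n j) l₀) (hp n j)))).1
      (hz ▸ ((hsum _ hone n).sub (hsum _ hB n)).hasSum)
    have h1 := sub_eq_zero.1 (congrFun h0 k)
    have hpk : prob n k ≠ 0 := by
      have : (k : ℝ) - n ≠ 0 := sub_ne_zero.2 (by exact_mod_cast hk)
      rw [prob, if_neg hk]; positivity
    exact ((pow_left_inj₀ (hX0 _ n k) (hX0 _ n k) (by omega)).1 (mul_right_cancel₀ hpk h1)).symm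
  intro n l
  simp [noiseSequence, matrixMoment, heq]

end BoxLocalization

end

open MeasureTheory
open scoped InnerProductSpace ComplexOrder

noncomputable section

namespace BoxLocalization

variable {H : Type*} [NormedAddCommGroup H] [InnerProductSpace ℂ H]

/-! Let `m_j(k,l)` denote `boxMoment j k l`, the matrix of multiplication by `x^j` on `L²[0, 2π)` in
the basis `e^{ikx}`, up to the sign convention for the frequencies. The moment operator `E^B[j]` has
the entries `B(k,l) m_j(k,l)` (`inner_moment_basis`), and Parseval's identity gives `m_1² = m_2`
(`hasSum_boxMoment_one_mul`), which is the noiselessness of `E¹`.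

The `(k,k)` entry of the noise of `E^B` is therefore `∑_m (1 - |B(k,m)|²) |m_1(k,m)|²`. Its terms
are nonnegative, and `m_1(k,m) = 1/(i(k-m))` does not vanish off the diagonal, so zero noise forces
`|B| = 1` everywhere. The first noise sequences give the same conclusion: `s_n(1)` is a sum of the
numbers `1 - |B(n,k)|` with weights that are positive for `k ≠ n`. Conversely `X_n^B` depends on
`|B|` only.

If `|B| = 1`, positivity makes `B` a cocycle, `B(k,m) B(m,l) = B(k,l)`
(`IsNormalizedPSD.mul_apply_of_norm_eq_one`). The diagonal unitary with eigenvalues `B(0,k)` then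
removes the phases of `B`, carrying `E^B` to `E¹`, and commutes with every `V_x`. Finally, unitary
equivalence transports moment operators, hence noise, and `E¹` has none. -/

/-! ### Densities recovered from set integrals -/

/-- A finite measure whose values are the set integrals of `h` has density `h`. -/
theorem integral_eq_integral_mul_of_forall_real_eq_setIntegral {α : Type*} [MeasurableSpace α]
    {μ ν : Measure α} [IsFiniteMeasure ν] {h : α → ℝ} (hh : Integrable h μ)
    (hν : ∀ X, MeasurableSet X → ν.real X = ∫ x in X, h x ∂μ) (f : α → ℝ) :
    ∫ x, f x ∂ν = ∫ x, f x * h x ∂μ := by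
  have hnn : 0 ≤ᵐ[μ] h := ae_nonneg_of_forall_setIntegral_nonneg hh fun X hX _ => by
    rw [← hν X hX]; exact measureReal_nonneg
  have hd : ν = μ.withDensity fun x => ENNReal.ofReal (h x) := by
    ext X hX
    rw [withDensity_apply _ hX, ← ofReal_integral_eq_lintegral_ofReal hh.integrableOn
      (ae_restrict_of_ae hnn), ← hν X hX, ofReal_measureReal]
  rw [hd, integral_withDensity_eq_integral_toReal_smul₀ hh.aemeasurable.ennreal_ofReal
    (Filter.Eventually.of_forall fun _ => ENNReal.ofReal_lt_top)]
  refine integral_congr_ae (hnn.mono fun x hx => ?_)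
  simp only [smul_eq_mul]
  rw [ENNReal.toReal_ofReal hx, mul_comm]

/-- A finite measure whose values are the set integrals of a complex function `h` has
density `h`. -/
theorem ofReal_integral_eq_integral_mul_of_forall_setIntegral {α : Type*} [MeasurableSpace α]
    {μ ν : Measure α} [IsFiniteMeasure ν] {h : α → ℂ} (hh : Integrable h μ)
    (hν : ∀ X, MeasurableSet X → ((ν.real X : ℝ) : ℂ) = ∫ x in X, h x ∂μ) (f : α → ℝ) :
    ((∫ x, f x ∂ν : ℝ) : ℂ) = ∫ x, (f x : ℂ) * h x ∂μ := by
  have hre : ∀ X, MeasurableSet X → ν.real X = ∫ x in X, (h x).re ∂μ := fun X hX => by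
    have := congrArg Complex.re (hν X hX)
    rw [Complex.ofReal_re] at this
    rw [this]
    exact (integral_re hh.integrableOn).symm
  -- The values of `ν` are real, so the imaginary part of `h` integrates to zero over every
  -- measurable set.
  have him : (fun x => (h x).im) =ᵐ[μ] 0 :=
    Integrable.ae_eq_zero_of_forall_setIntegral_eq_zero hh.im fun X hX _ => by
      have := congrArg Complex.im (hν X hX)
      rw [Complex.ofReal_im] at this
      rw [this]
      exact integral_im hh.integrableOn
  rw [integral_eq_integral_mul_of_forall_real_eq_setIntegral hh.re hre f, ← integral_complex_ofReal]
  refine integral_congr_ae (him.mono fun x hx => ?_)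
  have : h x = ((h x).re : ℂ) := Complex.ext (by simp) (by simpa using hx)
  simp only
  rw [this]
  simp

/-! ### Matrix entries of the moment operators -/

theorem SemispectralMeasure.ofReal_measure_real (E : SemispectralMeasure H) (φ : H) {X : Set Box}
    (hX : MeasurableSet X) : (((E.measure φ).real X : ℝ) : ℂ) = ⟪φ, E.op X φ⟫_ℂ := by
  rw [Measure.real, E.measure_apply φ hX, ENNReal.toReal_ofReal (E.re_inner_nonneg φ X)]
  obtain ⟨r, -, hr⟩ := RCLike.nonneg_iff_exists_ofReal.1 ((E.op_pos X hX).inner_nonneg_right φ)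
  rw [← hr]; simp

/-- `(2π)⁻¹ ∫ x^j e^{i(k-l)x} dx`, the matrix of the `j`-th moment of the canonical observable. -/
def boxMoment (j : ℕ) (k l : ℤ) : ℂ :=
  (1 / (2 * Real.pi) : ℂ) *
    ∫ x : Box, ((x : ℝ) : ℂ) ^ j * Complex.exp (Complex.I * ((k : ℂ) - l) * ((x : ℝ) : ℂ))

theorem integrable_exp_univ (k l : ℤ) : Integrable (fun x : Box =>
    Complex.exp (Complex.I * ((k : ℂ) - l) * ((x : ℝ) : ℂ))) :=
  integrableOn_univ.1 (integrable_exp Set.univ k l)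

theorem integrable_pow_mul_exp (j : ℕ) (k l : ℤ) : Integrable (fun x : Box =>
    ((x : ℝ) : ℂ) ^ j * Complex.exp (Complex.I * ((k : ℂ) - l) * ((x : ℝ) : ℂ))) := by
  refine (integrable_exp_univ k l).bdd_mul (c := (2 * Real.pi) ^ j) (by fun_prop)
    (Filter.Eventually.of_forall fun x => ?_)
  rw [norm_pow, Complex.norm_real, Real.norm_of_nonneg x.2.1]
  exact pow_le_pow_left₀ x.2.1 x.2.2.le j

theorem conj_boxMoment (j : ℕ) (k l : ℤ) :
    (starRingEnd ℂ) (boxMoment j k l) = boxMoment j l k := by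
  rw [boxMoment, boxMoment, map_mul, ← integral_conj]
  congr 1
  · rw [show (1 / (2 * Real.pi) : ℂ) = ((1 / (2 * Real.pi) : ℝ) : ℂ) by push_cast; rfl,
      Complex.conj_ofReal]
  · congr 1
    ext x
    rw [map_mul, ← Complex.exp_conj]
    congr 1
    · simp
    · congr 1
      simp
      ring

/-- On a vector `b k + z • b l` the sesquilinear form of `E(X)` has four terms. This splits both the
set integrals of the resulting density and its moments. -/
theorem integral_four_mul_add {α : Type*} [MeasurableSpace α] {μ : Measure α}
    {f₁ f₂ f₃ f₄ : α → ℂ} (h₁ : Integrable f₁ μ) (h₂ : Integrable f₂ μ) (h₃ : Integrable f₃ μ)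
    (h₄ : Integrable f₄ μ) (a₁ a₂ a₃ a₄ : ℂ) :
    ∫ x, (a₁ * f₁ x + a₂ * f₂ x + a₃ * f₃ x + a₄ * f₄ x) ∂μ =
      a₁ * ∫ x, f₁ x ∂μ + a₂ * ∫ x, f₂ x ∂μ + a₃ * ∫ x, f₃ x ∂μ + a₄ * ∫ x, f₄ x ∂μ := by
  have h₁₂ : Integrable (fun x => a₁ * f₁ x + a₂ * f₂ x) μ := (h₁.const_mul _).add (h₂.const_mul _)
  have h₁₃ : Integrable (fun x => a₁ * f₁ x + a₂ * f₂ x + a₃ * f₃ x) μ := h₁₂.add (h₃.const_mul _)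
  rw [integral_add h₁₃ (h₄.const_mul _), integral_add h₁₂ (h₃.const_mul _),
    integral_add (h₁.const_mul _) (h₂.const_mul _)]
  simp only [integral_const_mul]

/-- Moment operators are specified only through their quadratic forms. On a combination of two basis
vectors the measure has an explicit density, a combination of four exponentials weighted by entries
of `B`; integrating `x^j` against it gives the value. -/
theorem inner_moment_add_smul [CompleteSpace H] {b : HilbertBasis ℤ ℂ H}
    {E : SemispectralMeasure H} {B : Matrix ℤ ℤ ℂ} (hB : IsStructureMatrix b E B) (j : ℕ)
    (k l : ℤ) (z : ℂ) :
    ⟪b k + z • b l, E.moment j (b k + z • b l)⟫_ℂ =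
      B k k * boxMoment j k k + z * (B k l * boxMoment j k l)
        + star z * (B l k * boxMoment j l k) + star z * z * (B l l * boxMoment j l l) := by
  set e : ℤ → ℤ → Box → ℂ := fun k l x =>
    Complex.exp (Complex.I * ((k : ℂ) - l) * ((x : ℝ) : ℂ)) with he
  have hi : ∀ k l (X : Set Box), IntegrableOn (e k l) X := fun k l X => integrable_exp X k l
  have hi' : ∀ k l, Integrable (e k l) := integrable_exp_univ
  have hm : ∀ k l, Integrable fun x : Box => ((x : ℝ) : ℂ) ^ j * e k l x :=
    integrable_pow_mul_exp j
  set q : ℂ := 1 / (2 * Real.pi) with hq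
  set h : Box → ℂ := fun x => q * B k k * e k k x + q * z * B k l * e k l x
    + q * star z * B l k * e l k x + q * (star z * z) * B l l * e l l x with hh
  have key := ofReal_integral_eq_integral_mul_of_forall_setIntegral (μ := volume)
    (ν := E.measure (b k + z • b l)) (h := h)
    ((((hi' k k).const_mul _).add ((hi' k l).const_mul _)).add ((hi' l k).const_mul _) |>.add
      ((hi' l l).const_mul _))
    (fun X hX => by
      rw [E.ofReal_measure_real _ hX,
        integral_four_mul_add (hi k k X) (hi k l X) (hi l k X) (hi l l X)]
      rw [map_add, map_smul]
      simp only [inner_add_left, inner_add_right, inner_smul_left, inner_smul_right,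
        hB.inner_op X hX, boxFourier, Complex.star_def]
      ring) (fun x => (x : ℝ) ^ j)
  rw [E.inner_moment, key]
  have : ∀ x : Box, (((x : ℝ) ^ j : ℝ) : ℂ) * h x =
      q * B k k * (((x : ℝ) : ℂ) ^ j * e k k x) + q * z * B k l * (((x : ℝ) : ℂ) ^ j * e k l x)
      + q * star z * B l k * (((x : ℝ) : ℂ) ^ j * e l k x)
      + q * (star z * z) * B l l * (((x : ℝ) : ℂ) ^ j * e l l x) := fun x => by
    rw [hh]; push_cast; ring
  simp_rw [this]
  rw [integral_four_mul_add (hm k k) (hm k l) (hm l k) (hm l l)]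
  simp only [boxMoment]
  ring

/-- The moment operators of `E^B` have the entries `⟨k | E[j] | l⟩ = B(k, l) ⟨k | E¹[j] | l⟩`. -/
theorem inner_moment_basis [CompleteSpace H] {b : HilbertBasis ℤ ℂ H}
    {E : SemispectralMeasure H} {B : Matrix ℤ ℤ ℂ} (hB : IsStructureMatrix b E B) (j : ℕ)
    (k l : ℤ) : ⟪b k, E.moment j (b l)⟫_ℂ = B k l * boxMoment j k l := by
  have hd : ∀ k, ⟪b k, E.moment j (b k)⟫_ℂ = B k k * boxMoment j k k := fun k => by
    simpa using inner_moment_add_smul hB j k k 0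
  have h1 := inner_moment_add_smul hB j k l 1
  have h2 := inner_moment_add_smul hB j k l Complex.I
  rw [map_add, map_smul] at h1 h2
  simp only [inner_add_left, inner_add_right, inner_smul_left, inner_smul_right, hd,
    Complex.star_def, Complex.conj_I, map_one] at h1 h2
  -- Polarization: `z = 1` gives the sum of the `(k,l)` and `(l,k)` entries, `z = i` gives `i` times
  -- their difference. Half the first minus `i/2` times the second isolates `(k,l)`; the last term
  -- only replaces `i²` by `-1`.
  linear_combination (1 / 2 : ℂ) * h1 - (Complex.I / 2) * h2
    + (1 / 2 : ℂ) * (⟪b k, E.moment j (b l)⟫_ℂ - ⟪b l, E.moment j (b k)⟫_ℂ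
      - B k l * boxMoment j k l + B l k * boxMoment j l k) * Complex.I_sq

/-- Matrix multiplication of bounded operators: the left factor is moved onto `b k` by the adjoint,
and the inner product is expanded in the basis. -/
theorem hasSum_inner_moment_comp [CompleteSpace H] {b : HilbertBasis ℤ ℂ H}
    {E : SemispectralMeasure H} {B : Matrix ℤ ℤ ℂ} (hB : IsStructureMatrix b E B) (k l : ℤ) :
    HasSum (fun m => B k m * B m l * (boxMoment 1 k m * boxMoment 1 m l))
      ⟪b k, (E.moment 1 ∘L E.moment 1) (b l)⟫_ℂ := by
  have h := b.hasSum_inner_mul_inner (ContinuousLinearMap.adjoint (E.moment 1) (b k))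
    (E.moment 1 (b l))
  simp only [ContinuousLinearMap.adjoint_inner_left, inner_moment_basis hB] at h
  refine h.congr_fun fun m => ?_
  ring

/-! ### Fourier analysis of the canonical moments -/

/-- Parseval's identity for two functions on `[0, T)`. -/
theorem hasSum_conj_fourierCoeffOn_mul {T : ℝ} (hT : 0 < T) {f g : ℝ → ℂ} (hf : Continuous f)
    (hg : Continuous g) :
    HasSum (fun m => (starRingEnd ℂ) (fourierCoeffOn hT f m) * fourierCoeffOn hT g m)
      ((1 / T) • ∫ x in (0 : ℝ)..T, (starRingEnd ℂ) (f x) * g x) := by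
  have : Fact (0 < T) := ⟨hT⟩
  -- The lift to the circle may jump at `0`, since `f 0 = f T` is not assumed. It is still
  -- measurable and bounded, which suffices for `L²`.
  have hmem : ∀ f : ℝ → ℂ, Continuous f →
      MemLp (AddCircle.liftIco T 0 f) 2 AddCircle.haarAddCircle := fun f hf => by
    obtain ⟨C, hC⟩ := (isCompact_Icc (a := (0 : ℝ)) (b := 0 + T)).exists_bound_of_continuousOn
      hf.continuousOn
    refine MemLp.of_bound ?_ C (Filter.Eventually.of_forall fun x => ?_)
    · exact (hf.measurable.comp (measurable_subtype_coe.comp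
        (AddCircle.measurableEquivIco T 0).measurable)).aestronglyMeasurable
    · have hx := (AddCircle.equivIco T 0 x).2
      exact hC _ ⟨hx.1, hx.2.le⟩
  have hcoef : ∀ (f : ℝ → ℂ) (hf : Continuous f) (m : ℤ),
      ⟪fourierBasis m, (hmem f hf).toLp⟫_ℂ = fourierCoeffOn hT f m := fun f hf m => by
    rw [← HilbertBasis.repr_apply_apply, fourierBasis_repr,
      fourierCoeff_congr_ae (hmem f hf).coeFn_toLp, fourierCoeff_liftIco_eq]
    simp only [zero_add]
  have h := fourierBasis.hasSum_inner_mul_inner (hmem f hf).toLp (hmem g hg).toLp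
  have hin : ⟪(hmem f hf).toLp, (hmem g hg).toLp⟫_ℂ =
      (1 / T) • ∫ x in (0 : ℝ)..T, (starRingEnd ℂ) (f x) * g x := by
    -- Reading the inner product as a zeroth Fourier coefficient lets `fourierCoeff_liftIco_eq`
    -- convert the integral over the circle into one over the interval.
    have h1 : ⟪(hmem f hf).toLp, (hmem g hg).toLp⟫_ℂ =
        fourierCoeff (AddCircle.liftIco T 0 fun x => (starRingEnd ℂ) (f x) * g x) 0 := by
      rw [L2.inner_def, fourierCoeff]
      refine integral_congr_ae ?_
      filter_upwards [(hmem f hf).coeFn_toLp, (hmem g hg).coeFn_toLp] with x hx hy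
      rw [hx, hy]
      simp [AddCircle.liftIco, mul_comm]
    rw [h1, fourierCoeff_liftIco_eq, fourierCoeffOn_eq_integral]
    simp
  rw [hin] at h
  refine h.congr_fun fun m => ?_
  rw [← inner_conj_symm, hcoef f hf, hcoef g hg]

theorem boxMoment_eq_intervalIntegral (j : ℕ) (k l : ℤ) :
    boxMoment j k l = (1 / (2 * Real.pi)) •
      ∫ x in (0 : ℝ)..(2 * Real.pi), (x : ℂ) ^ j * Complex.exp (Complex.I * ((k : ℂ) - l) * x) := by
  rw [boxMoment, intervalIntegral.integral_of_le (by positivity), ← integral_Ico_eq_integral_Ioc,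
    ← integral_subtype measurableSet_Ico
      (fun x : ℝ => (x : ℂ) ^ j * Complex.exp (Complex.I * ((k : ℂ) - l) * (x : ℂ)))]
  simp

/-- The canonical observable has `E¹[2] = E¹[1]²`. -/
theorem hasSum_boxMoment_one_mul (k l : ℤ) :
    HasSum (fun m => boxMoment 1 k m * boxMoment 1 m l) (boxMoment 2 k l) := by
  -- `f k` is `x` times the `k`-th exponential. Its Fourier coefficients are row `k` of the first
  -- moment matrix, and the inner product of `f l` with `f k` is the second moment entry, so the
  -- claim is Parseval's identity.
  set f : ℤ → ℝ → ℂ := fun k x => (x : ℂ) * Complex.exp (Complex.I * k * x) with hf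
  have hcont : ∀ k, Continuous (f k) := fun k => by fun_prop
  have hpi : (Real.pi : ℂ) ≠ 0 := by exact_mod_cast Real.pi_ne_zero
  have hcoef : ∀ k m, fourierCoeffOn Real.two_pi_pos (f k) m = boxMoment 1 k m := fun k m => by
    rw [fourierCoeffOn_eq_integral, boxMoment_eq_intervalIntegral, sub_zero]
    congr 1
    refine intervalIntegral.integral_congr fun x _ => ?_
    simp only [hf, smul_eq_mul]
    rw [fourier_coe_apply, mul_left_comm, ← Complex.exp_add, pow_one]
    congr 2
    push_cast
    field_simp
    ring
  have h := hasSum_conj_fourierCoeffOn_mul Real.two_pi_pos (hcont l) (hcont k)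
  have hval : (1 / (2 * Real.pi)) • ∫ x in (0 : ℝ)..(2 * Real.pi),
      (starRingEnd ℂ) (f l x) * f k x = boxMoment 2 k l := by
    rw [boxMoment_eq_intervalIntegral]
    congr 1
    refine intervalIntegral.integral_congr fun x _ => ?_
    simp only [hf, map_mul, ← Complex.exp_conj, Complex.conj_ofReal, Complex.conj_I, map_intCast]
    rw [mul_mul_mul_comm, ← Complex.exp_add, sq]
    congr 2
    ring
  rw [hval] at h
  refine h.congr_fun fun m => ?_
  rw [hcoef, hcoef, conj_boxMoment, mul_comm]

/-- Integration by parts gives the value `1/(i(k-l))`: the exponential is periodic but `x` is not,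
so a boundary term survives. -/
theorem boxMoment_one_ne_zero {k l : ℤ} (hkl : k ≠ l) : boxMoment 1 k l ≠ 0 := by
  have hc : Complex.I * ((k : ℂ) - l) ≠ 0 :=
    mul_ne_zero Complex.I_ne_zero (sub_ne_zero.2 (by exact_mod_cast hkl))
  have hpi : (Real.pi : ℂ) ≠ 0 := by exact_mod_cast Real.pi_ne_zero
  set c := Complex.I * ((k : ℂ) - l) with hcdef
  have hd : ∀ x : ℝ, HasDerivAt (fun x : ℝ => ((x : ℂ) / c - 1 / c ^ 2) * Complex.exp (c * x))
      ((x : ℂ) ^ 1 * Complex.exp (c * x)) x := fun x => by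
    have h0 : HasDerivAt (fun x : ℝ => (x : ℂ)) 1 x := Complex.ofRealCLM.hasDerivAt
    have h2 := ((h0.div_const c).sub_const (1 / c ^ 2)).mul (h0.const_mul c).cexp
    refine h2.congr_deriv ?_
    field_simp
    ring
  have hexp : Complex.exp (c * ((2 * Real.pi : ℝ) : ℂ)) = 1 := by
    rw [Complex.exp_eq_one_iff]
    exact ⟨k - l, by rw [hcdef]; push_cast; ring⟩
  rw [boxMoment_eq_intervalIntegral, intervalIntegral.integral_eq_sub_of_hasDerivAt
    (fun x _ => hd x) (Continuous.intervalIntegrable (by fun_prop) _ _), hexp]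
  have : (((2 * Real.pi : ℝ) : ℂ) / c - 1 / c ^ 2) * 1
      - (((0 : ℝ) : ℂ) / c - 1 / c ^ 2) * Complex.exp (c * ((0 : ℝ) : ℂ)) = 2 * Real.pi / c := by
    simp
  rw [this]
  refine smul_ne_zero (by positivity) (div_ne_zero (mul_ne_zero two_ne_zero hpi) hc)

/-! ### Positive semidefinite matrices with unimodular entries -/

theorem IsNormalizedPSD.conj_apply {B : Matrix ℤ ℤ ℂ} (hB : IsNormalizedPSD B) (k l : ℤ) :
    (starRingEnd ℂ) (B k l) = B l k :=
  hB.posSemidef.1.apply l k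

theorem IsNormalizedPSD.mul_apply_symm {B : Matrix ℤ ℤ ℂ} (hB : IsNormalizedPSD B) (k l : ℤ) :
    B k l * B l k = ((‖B k l‖ ^ 2 : ℝ) : ℂ) := by
  rw [← hB.conj_apply k l, Complex.mul_conj, Complex.normSq_eq_norm_sq]

/-- An entry of modulus one of a normalized positive semidefinite matrix makes two of its columns
proportional. -/
theorem IsNormalizedPSD.mul_apply_of_norm_eq_one {B : Matrix ℤ ℤ ℂ} (hB : IsNormalizedPSD B)
    {m l : ℤ} (h : ‖B m l‖ = 1) (k : ℤ) : B k m * B m l = B k l := by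
  set w := B k l - B k m * B m l with hw
  have hu : B l m * B m l = 1 := by
    rw [mul_comm, hB.mul_apply_symm, h]; simp
  have hwc : (starRingEnd ℂ) w = B l k - B m k * B l m := by
    rw [hw, map_sub, map_mul, hB.conj_apply, hB.conj_apply, hB.conj_apply]
  -- For a Gram matrix of unit vectors `v_k` this is the equality case of Cauchy-Schwarz, `v_l =
  -- B(m,l) v_m`. The vector `(1, -B(m,l), 0)` is null for the form, and its pairing with the third
  -- coordinate is `w`; the third component `-w` then makes the form equal to `-|w|²`, which
  -- positivity allows only for `w = 0`.
  have hpos := (hB.posSemidef.submatrix ![l, m, k]).dotProduct_mulVec_nonneg ![1, -B m l, -w]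
  have hval : star ![1, -B m l, -w] ⬝ᵥ
      (B.submatrix ![l, m, k] ![l, m, k]).mulVec ![1, -B m l, -w]
      = -((starRingEnd ℂ) w * w) := by
    simp only [dotProduct, Matrix.mulVec, Fin.sum_univ_three, Matrix.submatrix_apply, Pi.star_apply,
      Matrix.cons_val_zero, Matrix.cons_val_one, Matrix.cons_val, Complex.star_def,
      map_neg, map_one, hB.conj_apply, hB.diag]
    rw [hwc, hw]
    linear_combination (-1 : ℂ) * hu
  rw [hval, Complex.conj_mul'] at hpos
  have h0 := (Complex.le_def.1 hpos).1
  have h1 : ‖w‖ ^ 2 ≤ 0 := by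
    have e : (-((‖w‖ : ℂ) ^ 2)).re = -‖w‖ ^ 2 := by rw [← Complex.ofReal_pow, Complex.neg_re, Complex.ofReal_re]
    rw [e] at h0
    simpa using h0
  have h2 : w = 0 := norm_eq_zero.1 (pow_eq_zero_iff two_ne_zero |>.1 (le_antisymm h1 (sq_nonneg _)))
  exact (sub_eq_zero.1 h2).symm

/-! ### Noise and the moduli of the entries -/

/-- The cocycle identity pulls `B k l` out of the series for the entries of `E[1]²`; what remains is
the canonical identity `m_1² = m_2`. -/
theorem isNoiseless_of_norm_eq_one [CompleteSpace H] {b : HilbertBasis ℤ ℂ H}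
    {E : SemispectralMeasure H} {B : Matrix ℤ ℤ ℂ} (hB : IsStructureMatrix b E B)
    (h : ∀ k l, ‖B k l‖ = 1) : E.IsNoiseless := by
  rw [SemispectralMeasure.IsNoiseless, SemispectralMeasure.noise, sub_eq_zero]
  refine ext_matrix b fun k l => ?_
  have h1 := hasSum_inner_moment_comp hB k l
  simp only [hB.normalizedPSD.mul_apply_of_norm_eq_one (h _ _)] at h1
  rw [inner_moment_basis hB]
  exact ((hasSum_boxMoment_one_mul k l).mul_left _).unique h1

/-- Subtracting the `(k,k)` entry of `E[1]²` from the canonical series leaves a vanishing sum of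
nonnegative terms, so each is zero; the factor `boxMoment 1 k l` can be cancelled off the diagonal.
-/
theorem norm_eq_one_of_isNoiseless [CompleteSpace H] {b : HilbertBasis ℤ ℂ H}
    {E : SemispectralMeasure H} {B : Matrix ℤ ℤ ℂ} (hB : IsStructureMatrix b E B)
    (h : E.IsNoiseless) (k l : ℤ) : ‖B k l‖ = 1 := by
  have hP := hB.normalizedPSD
  by_cases hkl : k = l
  · rw [hkl, hP.diag, norm_one]
  rw [SemispectralMeasure.IsNoiseless, SemispectralMeasure.noise, sub_eq_zero] at h
  have h1 := hasSum_inner_moment_comp hB k k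
  rw [← h, inner_moment_basis hB, hP.diag, one_mul] at h1
  have h2 := (hasSum_boxMoment_one_mul k k).sub h1
  rw [sub_self] at h2
  have h3 : HasSum (fun m => (1 - ‖B k m‖ ^ 2) * ‖boxMoment 1 k m‖ ^ 2) 0 := by
    rw [← Complex.hasSum_ofReal]
    refine h2.congr_fun fun m => ?_
    rw [hP.mul_apply_symm, ← conj_boxMoment 1 k m, Complex.mul_conj']
    push_cast
    ring
  have hnn : ∀ m, 0 ≤ (1 - ‖B k m‖ ^ 2) * ‖boxMoment 1 k m‖ ^ 2 := fun m =>
    mul_nonneg (sub_nonneg.2 (pow_le_one₀ (norm_nonneg _) (hP.norm_le_one k m))) (sq_nonneg _)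
  have h4 := congrFun ((hasSum_zero_iff_of_nonneg hnn).1 h3) l
  have h5 : 1 - ‖B k l‖ ^ 2 = 0 := (mul_eq_zero.1 h4).resolve_right
    (pow_ne_zero _ (norm_ne_zero_iff.2 (boxMoment_one_ne_zero hkl)))
  exact (pow_eq_one_iff_of_nonneg (norm_nonneg _) two_ne_zero).1 (by linarith)

/-! ### Unitary equivalence -/

theorem inner_conjugate (U : H ≃ₗᵢ[ℂ] H) (T : H →L[ℂ] H) (φ ψ : H) :
    ⟪φ, conjugate U T ψ⟫_ℂ = ⟪U.symm φ, T (U.symm ψ)⟫_ℂ :=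
  (U.symm.inner_map_eq_flip φ (T (U.symm ψ))).symm

theorem conjugate_comp (U : H ≃ₗᵢ[ℂ] H) (S T : H →L[ℂ] H) :
    conjugate U (S ∘L T) = conjugate U S ∘L conjugate U T := by
  ext ψ; simp [conjugate]

/-- The measure of `E` at `U* φ` is the measure of `F` at `φ`, so the quadratic forms of both sides
agree; over `ℂ` these determine the operators. -/
theorem conjugate_moment [CompleteSpace H] {E F : SemispectralMeasure H} {U : H ≃ₗᵢ[ℂ] H}
    (h : ∀ X, MeasurableSet X → conjugate U (E.op X) = F.op X) (j : ℕ) :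
    conjugate U (E.moment j) = F.moment j := by
  refine ContinuousLinearMap.coe_injective ((ext_inner_map _ _).1 fun φ => ?_)
  have hμ : E.measure (U.symm φ) = F.measure φ := by
    ext X hX
    rw [E.measure_apply _ hX, F.measure_apply _ hX, ← h X hX, inner_conjugate]
  rw [← inner_conj_symm, ← inner_conj_symm _ φ]
  congr 1
  exact (inner_conjugate U _ φ φ).trans
    ((E.inner_moment j _).trans (by rw [hμ]; exact (F.inner_moment j φ).symm))

theorem isNoiseless_of_conjugate_eq [CompleteSpace H] {E F : SemispectralMeasure H}
    {U : H ≃ₗᵢ[ℂ] H} (h : ∀ X, MeasurableSet X → conjugate U (E.op X) = F.op X)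
    (hF : F.IsNoiseless) : E.IsNoiseless := by
  rw [SemispectralMeasure.IsNoiseless, SemispectralMeasure.noise, sub_eq_zero] at hF ⊢
  rw [← conjugate_moment h, ← conjugate_moment h, ← conjugate_comp] at hF
  ext ψ
  have := congrArg U.symm (DFunLike.congr_fun hF (U ψ))
  simpa [conjugate] using this

theorem isNoiseless_canonicalObservable [CompleteSpace H] (b : HilbertBasis ℤ ℂ H) :
    (canonicalObservable b).IsNoiseless :=
  isNoiseless_of_norm_eq_one (boxObservable_isStructureMatrix b _ _) fun _ _ => by simp [oneMatrix]

/-- The unitary operator with `|k⟩ ↦ c(k) |k⟩`. -/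
theorem exists_diagonal_unitary [CompleteSpace H] (b : HilbertBasis ℤ ℂ H) {c : ℤ → ℂ}
    (hc : ∀ k, ‖c k‖ = 1) : ∃ U : H ≃ₗᵢ[ℂ] H, ∀ k, U (b k) = c k • b k := by
  classical
  have hc0 : ∀ k, c k ≠ 0 := fun k => norm_ne_zero_iff.1 (by simp [hc k])
  have ho : Orthonormal ℂ fun k => c k • b k := by
    rw [orthonormal_iff_ite]
    intro k l
    rw [inner_smul_left, inner_smul_right, orthonormal_iff_ite.1 b.orthonormal k l]
    split_ifs with h
    · subst h
      rw [mul_one, Complex.conj_mul', hc]; simp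
    · simp
  have hd : ⊤ ≤ (Submodule.span ℂ (Set.range fun k => c k • b k)).topologicalClosure := by
    rw [← b.dense_span]
    refine Submodule.topologicalClosure_mono (Submodule.span_le.2 ?_)
    rintro _ ⟨k, rfl⟩
    have h := Submodule.smul_mem _ (c k)⁻¹
      (Submodule.subset_span (R := ℂ) (Set.mem_range_self (f := fun k => c k • b k) k))
    rwa [inv_smul_smul₀ (hc0 k)] at h
  refine ⟨b.repr.trans (HilbertBasis.mk ho hd).repr.symm, fun k => ?_⟩
  rw [LinearIsometryEquiv.trans_apply, b.repr_self, HilbertBasis.repr_symm_single,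
    HilbertBasis.coe_mk]

/-- Conjugating by the diagonal unitary with phases `B 0 k` multiplies the `(k,l)` entry by `B 0 k *
B l 0`, and the cocycle identity gives `B 0 k * B k l * B l 0 = 1`. The reference index `0` is
arbitrary. The translations are diagonal in the same basis, so they are unchanged. -/
theorem isUnitarilyEquivalent_of_norm_eq_one [CompleteSpace H] {b : HilbertBasis ℤ ℂ H}
    {E : SemispectralMeasure H} {B : Matrix ℤ ℤ ℂ} (hB : IsStructureMatrix b E B)
    (h : ∀ k l, ‖B k l‖ = 1) : IsUnitarilyEquivalent b E (canonicalObservable b) := by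
  have hP := hB.normalizedPSD
  have hmul := fun k m l => hP.mul_apply_of_norm_eq_one (h m l) k
  obtain ⟨U, hU⟩ := exists_diagonal_unitary b (c := fun k => B 0 k) fun k => h 0 k
  have hUs : ∀ k, U.symm (b k) = B k 0 • b k := fun k => by
    rw [LinearIsometryEquiv.symm_apply_eq, map_smul, hU, smul_smul, hmul, hP.diag, one_smul]
  refine ⟨U, fun X hX => ext_matrix b fun k l => ?_, fun x => ext_matrix b fun k l => ?_⟩
  · rw [inner_conjugate, hUs, hUs, map_smul, inner_smul_left, inner_smul_right, hB.inner_op X hX,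
      canonicalObservable, (boxObservable_isStructureMatrix b _ oneMatrix_isNormalizedPSD).inner_op X hX, hP.conj_apply]
    have : B 0 k * B k l * B l 0 = 1 := by rw [hmul, hmul, hP.diag]
    simp only [oneMatrix, Matrix.of_apply]
    linear_combination boxFourier X k l * this
  · rw [inner_conjugate, hUs, hUs, map_smul]
    simp only [ContinuousLinearEquiv.coe_coe, LinearIsometryEquiv.coe_toContinuousLinearEquiv]
    rw [translation_apply, inner_smul_left, inner_smul_right, inner_smul_right,
      orthonormal_iff_ite.1 b.orthonormal k l, hP.conj_apply]
    split_ifs with hkl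
    · subst hkl
      have : B 0 k * B k 0 = 1 := by rw [hmul, hP.diag]
      linear_combination Complex.exp (Complex.I * x * k) * this
    · simp

/-! ### Noise sequences of the matrix -/

/-- The first moment suffices: `s_n(1)` is the sum of `1 - ‖B n k‖` against nonnegative weights that
are nonzero for `k ≠ n`. The entry `k = n`, which the weights do not see, is covered by the
normalization. -/
theorem norm_eq_one_of_isNoiselessMatrix {B : Matrix ℤ ℤ ℂ} (hB : IsNormalizedPSD B)
    (h : IsNoiselessMatrix B) (n k : ℤ) : ‖B n k‖ = 1 := by
  by_cases hk : k = n
  · rw [hk, hB.diag, norm_one]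
  have hp : ∀ k, 0 ≤ prob n k := fun k => by
    rw [prob]; split_ifs
    · exact le_rfl
    · positivity
  -- At `j = n` both sides vanish because `prob n n = 0`, so the convention `randomVar C n n = 0`
  -- does no harm.
  have hterm : ∀ (C : Matrix ℤ ℤ ℂ) (j : ℤ), randomVar C n j ^ 1 * prob n j
      = ‖C n j‖ * (Real.pi / √3 * prob n j) := fun C j => by
    rw [randomVar, prob, pow_one]; split_ifs
    · simp
    · ring
  have hs : Summable fun j => Real.pi / √3 * prob n j := (summable_prob n).mul_left _
  have hw : ∀ j, 0 ≤ Real.pi / √3 * prob n j := fun j => mul_nonneg (by positivity) (hp j)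
  have hsB : Summable fun j => ‖B n j‖ * (Real.pi / √3 * prob n j) :=
    Summable.of_nonneg_of_le (fun j => mul_nonneg (norm_nonneg _) (hw j))
      (fun j => mul_le_of_le_one_left (hw j) (hB.norm_le_one n j)) hs
  have h1 := h n 1
  simp only [noiseSequence, matrixMoment, hterm, oneMatrix, Matrix.of_apply, norm_one,
    one_mul] at h1
  have h2 := hs.hasSum.sub hsB.hasSum
  rw [h1] at h2
  have h3 := congrFun ((hasSum_zero_iff_of_nonneg fun j => sub_nonneg.2
    (mul_le_of_le_one_left (hw j) (hB.norm_le_one n j))).1 h2) k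
  have hpk : Real.pi / √3 * prob n k ≠ 0 := by
    have : (k : ℝ) - n ≠ 0 := sub_ne_zero.2 (by exact_mod_cast hk)
    rw [prob, if_neg hk]; positivity
  refine mul_right_cancel₀ hpk ?_
  rw [one_mul]
  exact (sub_eq_zero.1 h3).symm

theorem isNoiselessMatrix_of_norm_eq_one {B : Matrix ℤ ℤ ℂ} (h : ∀ k l, ‖B k l‖ = 1) :
    IsNoiselessMatrix B := fun n l => by
  simp [noiseSequence, matrixMoment, randomVar, oneMatrix, h]

end BoxLocalization

end

/-! ### The equivalence -/

theorem corollary2 {H : Type*} [NormedAddCommGroup H] [InnerProductSpace ℂ H] [CompleteSpace H]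
    (b : HilbertBasis ℤ ℂ H) (E : BoxLocalization.SemispectralMeasure H)
    (hE : BoxLocalization.IsCovariant b E)
    (B : Matrix ℤ ℤ ℂ) (hB : BoxLocalization.IsStructureMatrix b E B) :
    List.TFAE [
      E.IsNoiseless,
      BoxLocalization.IsNoiselessMatrix B,
      ∀ k l : ℤ, ‖B k l‖ = 1,
      BoxLocalization.IsUnitarilyEquivalent b E (BoxLocalization.canonicalObservable b)] := by
  tfae_have 1 → 3 := BoxLocalization.norm_eq_one_of_isNoiseless hB
  tfae_have 3 → 4 := BoxLocalization.isUnitarilyEquivalent_of_norm_eq_one hB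
  tfae_have 4 → 1 := fun ⟨_, hU, _⟩ => BoxLocalization.isNoiseless_of_conjugate_eq hU
    (BoxLocalization.isNoiseless_canonicalObservable b)
  tfae_have 2 → 3 := BoxLocalization.norm_eq_one_of_isNoiselessMatrix hB.normalizedPSD
  tfae_have 3 → 2 := BoxLocalization.isNoiselessMatrix_of_norm_eq_one
  tfae_finish
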